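/- For integers $k_1,\ldots,k_n\ge 1$ with $k_n\ge 2$ put \[ \zeta^{\star}(k_1,\ldots,k_n)=\sum_{0<m_1\le\cdots\le m_n}\frac{1}{m_1^{k_1}\cdots m_n^{k_n}}, \qquad \zeta^{\star}_{-}(k_1,\ldots,k_n)=\sum_{0<m_1\le\cdots\le m_n}\frac{(-1)^{m_n-1}}{m_1^{k_1}\cdots m_n^{k_n}}, \] where the $m_j$ are integers. Then for all integers $r\ge 0$ and $s\ge 1$, all the series occurring below converge absolutely and \[ \zeta^{\star}(r+2,\underbrace{2,\ldots,2}_{s-1}) =\sum_{i=0}^{r}(-1)^{r-i}\,2^{i+1} \sum_{\substack{k_1+\cdots+k_{i+1}=r+1\\ k_1,\ldots,k_{i+1}\in\mathbb{Z}_{\ge 1}}} \zeta^{\star}_{-}(k_1,\ldots,k_i,\,k_{i+1}+2s-1). \] -/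

import Mathlib

/-- The index set of a star series of depth `n`: the tuples of positive integers
`0 < m_1 ≤ ⋯ ≤ m_n`. -/
def StarIndex (n : ℕ) : Type :=
  {m : Fin n → ℕ // (∀ j, 0 < m j) ∧ Monotone m}

/-- The general term `1 / (m_1 ^ k_1 ⋯ m_n ^ k_n)`. -/
noncomputable def starTerm {n : ℕ} (k : Fin n → ℕ) (m : StarIndex n) : ℝ :=
  1 / ∏ j, (m.1 j : ℝ) ^ k j

/-- The general term `(-1) ^ (m_n - 1) / (m_1 ^ k_1 ⋯ m_n ^ k_n)`, of depth `n + 1` here so that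
there is a last index. -/
noncomputable def altStarTerm {n : ℕ} (k : Fin (n + 1) → ℕ) (m : StarIndex (n + 1)) : ℝ :=
  (-1 : ℝ) ^ (m.1 (Fin.last n) - 1) / ∏ j, (m.1 j : ℝ) ^ k j

/-- The multiple zeta-star value `ζ⋆(k_1, …, k_n)`; the series converges absolutely when all
`k_j ≥ 1` and `k_n ≥ 2`. -/
noncomputable def zetaStar {n : ℕ} (k : Fin n → ℕ) : ℝ :=
  ∑' m : StarIndex n, starTerm k m

/-- The alternating star value `ζ⋆₋(k_1, …, k_{n+1})`; the series converges absolutely when all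
`k_j ≥ 1` and the last one is at least `2`, the only case in which it is used. -/
noncomputable def altZetaStar {n : ℕ} (k : Fin (n + 1) → ℕ) : ℝ :=
  ∑' m : StarIndex (n + 1), altStarTerm k m

/-- The tuples `(k_1, …, k_n)` of positive integers with `k_1 + ⋯ + k_n = w`. -/
def positiveTuples (n w : ℕ) : Finset (Fin n → ℕ) :=
  (Finset.Nat.antidiagonalTuple n w).filter fun k => ∀ j, 1 ≤ k j

/-- The tuple `(a, 2, …, 2)` of length `s`, with `s - 1` twos. -/
def headThenTwos (a s : ℕ) : Fin s → ℕ :=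
  fun j => if (j : ℕ) = 0 then a else 2

/-- The tuple `(k_1, …, k_i, k_{i+1} + c)`. -/
def addToLast {i : ℕ} (k : Fin (i + 1) → ℕ) (c : ℕ) : Fin (i + 1) → ℕ :=
  Function.update k (Fin.last i) (k (Fin.last i) + c)

/-!
# A formula for `ζ⋆(r + 2, 2, …, 2)` in alternating star values

The identity holds already for sums truncated at `N`, once the term with largest index `n` on the
alternating side is given the weight `w_N(n) = N! ^ 2 / ((N - n)! (N + n)!)` (`centralWeight`);
the theorem is its limit `N → ∞`.

For fixed largest index `n`, the inner sum over `i` and over compositions is the coefficient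
`c_r(n)` of `y ^ (r + 1)` in `2 y / (n - y) * P_{n - 1}`, where
`P_n = ∏_{m ≤ n} (m + y) / (m - y)`: a distinct index `m` contributes
`1 / (1 - 2 y / (m + y)) = (m + y) / (m - y)`. The relation `(n - y) P_n = (n + y) P_{n - 1}`
becomes `mul_compositionSlice`, that is `n c_r(n) = p_r(n) + p_r(n - 1)` for the coefficients
`p_r(n)` of `y ^ r` in `P_n`. It is proved directly, by splitting compositions according to
whether their last part exceeds `1` (`sum_positiveTuples_succ`).

Because `w_N(n + 1) (N + n + 1) = w_N(n) (N - n)`, the alternating sums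
`∑ (-1) ^ (n - 1) w_N(n) ((N - n) q(n) + (N + n) q(n - 1))` telescope
(`sum_centralWeight_telescope`). Induction on `r` with `q = p_r` then gives
`∑_{n ≤ N} (-1) ^ (n - 1) w_N(n) n c_r(n) = N ^ (-r)` (`sum_centralWeight_compositionSum`).
Dividing by `N ^ 2` and summing over `N` multiplies the coefficient of `w_N(n)` by `n ^ (-2)`
(`sum_inv_sq_mul_centralWeight`); doing so `s` times produces the truncated value of
`ζ⋆(r + 2, 2, …, 2)` on the left (`truncatedStar_headThenTwos`).

Finally `0 ≤ w_N(n) ≤ 1` and `w_N(n) → 1`, so dominated convergence applies. Absolute convergence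
of the star series comes from bounding the sum over all indices but the largest by a power of a
harmonic number.
-/

/-! ### The weights -/

/-- The weight `N! ^ 2 / ((N - n)! (N + n)!)`, written as a product so that it vanishes for
`n > N`. -/
noncomputable def centralWeight (N n : ℕ) : ℝ :=
  ∏ j ∈ Finset.range n, ((N : ℝ) - j) / (N + j + 1)

lemma centralWeight_zero (N : ℕ) : centralWeight N 0 = 1 := by
  simp [centralWeight]

lemma centralWeight_succ (N n : ℕ) :
    centralWeight N (n + 1) * (N + n + 1) = centralWeight N n * (N - n) := by
  have : (N : ℝ) + n + 1 ≠ 0 := by positivity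
  rw [centralWeight, Finset.prod_range_succ, ← centralWeight]
  field_simp

lemma centralWeight_eq_zero {N n : ℕ} (h : N < n) : centralWeight N n = 0 :=
  Finset.prod_eq_zero (Finset.mem_range.2 h) (by simp)

lemma centralWeight_nonneg (N n : ℕ) : 0 ≤ centralWeight N n := by
  rcases lt_or_ge N n with h | h
  · rw [centralWeight_eq_zero h]
  · refine Finset.prod_nonneg fun j hj => div_nonneg ?_ (by positivity)
    rw [sub_nonneg]
    exact_mod_cast ((Finset.mem_range.1 hj).trans_le h).le

lemma centralWeight_le_one (N n : ℕ) : centralWeight N n ≤ 1 := by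
  rcases lt_or_ge N n with h | h
  · rw [centralWeight_eq_zero h]; exact zero_le_one
  · refine Finset.prod_le_one (fun j hj => div_nonneg ?_ (by positivity)) fun j _ => ?_
    · rw [sub_nonneg]
      exact_mod_cast ((Finset.mem_range.1 hj).trans_le h).le
    · rw [div_le_one (by positivity)]
      have : (0 : ℝ) ≤ j := by positivity
      linarith

lemma tendsto_centralWeight (n : ℕ) :
    Filter.Tendsto (fun N => centralWeight N n) Filter.atTop (nhds 1) := by
  have key (j : ℕ) : Filter.Tendsto (fun N : ℕ => ((N : ℝ) - j) / (N + j + 1))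
      Filter.atTop (nhds 1) := by
    have h1 : Filter.Tendsto (fun N : ℕ => (2 * j + 1 : ℝ) / ((N : ℝ) + (j + 1)))
        Filter.atTop (nhds 0) :=
      Filter.Tendsto.const_div_atTop
        (Filter.tendsto_atTop_add_const_right _ _ tendsto_natCast_atTop_atTop) _
    have h2 := h1.const_sub 1
    rw [sub_zero] at h2
    refine h2.congr fun N => ?_
    have : (N : ℝ) + j + 1 ≠ 0 := by positivity
    field_simp
    ring
  have h := tendsto_finsetProd (Finset.range n) fun j _ => key j
  rwa [Finset.prod_const_one] at h

lemma centralWeight_succ_left (N n : ℕ) :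
    ((N : ℝ) + 1) ^ 2 * centralWeight N n =
      (((N : ℝ) + 1) ^ 2 - n ^ 2) * centralWeight (N + 1) n := by
  induction n with
  | zero => simp [centralWeight_zero]
  | succ n ih =>
    have h1 : (N : ℝ) + n + 1 ≠ 0 := by positivity
    have h2 := centralWeight_succ N n
    have h3 := centralWeight_succ (N + 1) n
    push_cast at h3 ⊢
    apply mul_right_cancel₀ h1
    linear_combination ((N : ℝ) + 1) ^ 2 * h2 + (N - n) * ih
      - (N - n) * (N + n + 1) * h3

/-- Summation by parts against the alternating weights: consecutive coefficients of each value
`q n`, `0 < n`, cancel. -/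
lemma sum_centralWeight_telescope (q : ℕ → ℝ) (N : ℕ) :
    ∑ n ∈ Finset.range N, (-1 : ℝ) ^ n * centralWeight N (n + 1) *
      ((N - (n + 1)) * q (n + 1) + (N + (n + 1)) * q n) = N * q 0 := by
  have key (K : ℕ) : ∑ n ∈ Finset.range K, (-1 : ℝ) ^ n * centralWeight N (n + 1) *
      ((N - (n + 1)) * q (n + 1) + (N + (n + 1)) * q n) =
        N * q 0 - (-1) ^ K * centralWeight N K * (N - K) * q K := by
    induction K with
    | zero => simp [centralWeight_zero]
    | succ K ih =>
      rw [Finset.sum_range_succ, ih]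
      have h := centralWeight_succ N K
      push_cast
      linear_combination (-1 : ℝ) ^ K * q K * h
  rw [key]; simp

/-- The operator `g ↦ (N ↦ ∑_{M ≤ N} g M / M ^ 2)` divides the coefficient of `centralWeight N n`
by `n ^ 2`. -/
lemma sum_inv_sq_mul_centralWeight (a : ℕ → ℝ) (N : ℕ) :
    ∑ M ∈ Finset.range N, (((M : ℝ) + 1) ^ 2)⁻¹ *
        ∑ n ∈ Finset.range (M + 1), a n * centralWeight (M + 1) (n + 1) =
      ∑ n ∈ Finset.range N, a n * (((n : ℝ) + 1) ^ 2)⁻¹ * centralWeight N (n + 1) := by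
  induction N with
  | zero => simp
  | succ N ih =>
    have h0 : ∑ n ∈ Finset.range N, a n * (((n : ℝ) + 1) ^ 2)⁻¹ * centralWeight N (n + 1) =
        ∑ n ∈ Finset.range (N + 1), a n * (((n : ℝ) + 1) ^ 2)⁻¹ * centralWeight N (n + 1) := by
      rw [Finset.sum_range_succ, centralWeight_eq_zero (Nat.lt_succ_self N)]; simp
    rw [Finset.sum_range_succ, ih, h0, Finset.mul_sum, ← Finset.sum_add_distrib]
    refine Finset.sum_congr rfl fun n _ => ?_
    have h := centralWeight_succ_left N (n + 1)
    have h1 : (N : ℝ) + 1 ≠ 0 := by positivity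
    have h2 : (n : ℝ) + 1 ≠ 0 := by positivity
    push_cast at h
    field_simp
    linear_combination a n * h

/-! ### Truncated star sums -/

open Classical in
/-- The tuples of integers `1 ≤ m_1 ≤ ⋯ ≤ m_n ≤ N`. -/
noncomputable def boundedTuples (n N : ℕ) : Finset (Fin n → ℕ) :=
  (Fintype.piFinset fun _ => Finset.Icc 1 N).filter Monotone

lemma mem_boundedTuples {n N : ℕ} {m : Fin n → ℕ} :
    m ∈ boundedTuples n N ↔ (∀ j, 1 ≤ m j ∧ m j ≤ N) ∧ Monotone m := by
  simp [boundedTuples, Fintype.mem_piFinset]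

/-- The truncated star sum `∑ 1 / (m_1 ^ k_1 ⋯ m_n ^ k_n)` over `1 ≤ m_1 ≤ ⋯ ≤ m_n ≤ N`. -/
noncomputable def truncatedStar {n : ℕ} (k : Fin n → ℕ) (N : ℕ) : ℝ :=
  ∑ m ∈ boundedTuples n N, ∏ j, ((m j : ℝ) ^ k j)⁻¹

/-- The part of the star sum `∑ 1 / (m_1 ^ k_1 ⋯ m_{n+1} ^ k_{n+1})` with `m_{n+1} = M`. -/
noncomputable def starSlice {n : ℕ} (k : Fin (n + 1) → ℕ) (M : ℕ) : ℝ :=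
  ((M : ℝ) ^ k (Fin.last n))⁻¹ * truncatedStar (Fin.init k) M

lemma monotone_snoc {n M : ℕ} {m : Fin n → ℕ} (hm : Monotone m) (h : ∀ j, m j ≤ M) :
    Monotone (Fin.snoc m M : Fin (n + 1) → ℕ) := by
  intro i j hij
  induction j using Fin.lastCases with
  | last =>
    induction i using Fin.lastCases with
    | last => exact le_rfl
    | cast i => simpa using h i
  | cast j =>
    induction i using Fin.lastCases with
    | last => exact absurd hij (by simp)
    | cast i => simpa using hm (by simpa using hij)

lemma prod_snoc_inv {n M : ℕ} (k : Fin (n + 1) → ℕ) (m : Fin n → ℕ) :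
    ∏ j, (((Fin.snoc m M : Fin (n + 1) → ℕ) j : ℝ) ^ k j)⁻¹ =
      ((M : ℝ) ^ k (Fin.last n))⁻¹ * ∏ j, ((m j : ℝ) ^ Fin.init k j)⁻¹ := by
  rw [Fin.prod_univ_castSucc, mul_comm]
  simp [Fin.init]

lemma truncatedStar_zero (k : Fin 0 → ℕ) (N : ℕ) : truncatedStar k N = 1 := by
  have : boundedTuples 0 N = Finset.univ := by
    ext m
    simp only [mem_boundedTuples, Subsingleton.monotone, Finset.mem_univ, iff_true, and_true]
    exact fun j => j.elim0
  simp [truncatedStar, this]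

lemma truncatedStar_succ {n : ℕ} (k : Fin (n + 1) → ℕ) (N : ℕ) :
    truncatedStar k N = ∑ M ∈ Finset.range N, starSlice k (M + 1) := by
  simp only [truncatedStar, starSlice, Finset.mul_sum]
  rw [Finset.sum_sigma']
  symm
  refine Finset.sum_bij' (fun x _ => (Fin.snoc x.2 (x.1 + 1) : Fin (n + 1) → ℕ))
    (fun m _ => ⟨m (Fin.last n) - 1, Fin.init m⟩) ?_ ?_ ?_ ?_ ?_
  · rintro ⟨M, m⟩ h
    simp only [Finset.mem_sigma, Finset.mem_range, mem_boundedTuples] at h ⊢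
    refine ⟨fun j => ?_, monotone_snoc h.2.2 fun j => (h.2.1 j).2⟩
    induction j using Fin.lastCases with
    | last => simp; omega
    | cast j => simpa using ⟨(h.2.1 j).1, (h.2.1 j).2.trans (by omega)⟩
  · intro m h
    simp only [Finset.mem_sigma, Finset.mem_range, mem_boundedTuples] at h ⊢
    have hl := h.1 (Fin.last n)
    refine ⟨by omega, fun j => ⟨(h.1 _).1, ?_⟩, fun i j hij => h.2 (by simpa using hij)⟩
    rw [Nat.sub_add_cancel hl.1]
    exact h.2 (Fin.le_last _)
  · rintro ⟨M, m⟩ h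
    simp
  · intro m h
    simp only [mem_boundedTuples] at h
    simp only [Nat.sub_add_cancel (h.1 (Fin.last n)).1, Fin.snoc_init_self]
  · rintro ⟨M, m⟩ h
    exact (prod_snoc_inv k m).symm

lemma truncatedStar_nonneg {n : ℕ} (k : Fin n → ℕ) (N : ℕ) : 0 ≤ truncatedStar k N :=
  Finset.sum_nonneg fun _ _ => Finset.prod_nonneg fun _ _ => by positivity

lemma starSlice_nonneg {n : ℕ} (k : Fin (n + 1) → ℕ) (M : ℕ) : 0 ≤ starSlice k M :=
  mul_nonneg (by positivity) (truncatedStar_nonneg _ _)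

/-! ### Star series as series over the largest index -/

/-- Star indices of depth `n + 1` sorted by their last entry `M + 1`. -/
noncomputable def starIndexEquiv (n : ℕ) :
    (Σ M : ℕ, boundedTuples n (M + 1)) ≃ StarIndex (n + 1) where
  toFun x := ⟨Fin.snoc x.2.1 (x.1 + 1), by
    have h := mem_boundedTuples.1 x.2.2
    refine ⟨fun j => ?_, monotone_snoc h.2 fun j => (h.1 j).2⟩
    induction j using Fin.lastCases with
    | last => simp
    | cast j => simpa using Nat.lt_of_succ_le (h.1 j).1⟩
  invFun m := ⟨m.1 (Fin.last n) - 1, Fin.init m.1, by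
    refine mem_boundedTuples.2 ⟨fun j => ⟨m.2.1 _, ?_⟩, fun i j hij => m.2.2 (by simpa using hij)⟩
    rw [Nat.sub_add_cancel (m.2.1 _)]
    exact m.2.2 (Fin.le_last _)⟩
  left_inv := by
    rintro ⟨M, m, h⟩
    exact Sigma.subtype_ext (by simp) (by simp)
  right_inv := by
    rintro ⟨m, h⟩
    apply Subtype.ext
    simp only [Nat.sub_add_cancel (h.1 (Fin.last n)), Fin.snoc_init_self]

lemma starTerm_starIndexEquiv {n : ℕ} (k : Fin (n + 1) → ℕ) (M : ℕ)
    (m : boundedTuples n (M + 1)) :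
    starTerm k (starIndexEquiv n ⟨M, m⟩) =
      (((M + 1 : ℕ) : ℝ) ^ k (Fin.last n))⁻¹ * ∏ j, ((m.1 j : ℝ) ^ Fin.init k j)⁻¹ := by
  rw [← prod_snoc_inv, Finset.prod_inv_distrib, starTerm, one_div]
  rfl

lemma altStarTerm_eq {n : ℕ} (k : Fin (n + 1) → ℕ) (m : StarIndex (n + 1)) :
    altStarTerm k m = (-1) ^ (m.1 (Fin.last n) - 1) * starTerm k m := by
  rw [altStarTerm, starTerm, mul_one_div]

lemma starTerm_nonneg {n : ℕ} (k : Fin n → ℕ) (m : StarIndex n) : 0 ≤ starTerm k m := by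
  unfold starTerm
  positivity

lemma sum_fiber_starTerm {n : ℕ} (k : Fin (n + 1) → ℕ) (M : ℕ) :
    ∑ m : boundedTuples n (M + 1), starTerm k (starIndexEquiv n ⟨M, m⟩) = starSlice k (M + 1) := by
  simp_rw [starTerm_starIndexEquiv, starSlice, truncatedStar, Finset.mul_sum]
  exact Finset.sum_coe_sort (boundedTuples n (M + 1)) fun m =>
    (((M + 1 : ℕ) : ℝ) ^ k (Fin.last n))⁻¹ * ∏ j, ((m j : ℝ) ^ Fin.init k j)⁻¹

lemma summable_starTerm {n : ℕ} {k : Fin (n + 1) → ℕ}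
    (h : Summable fun M => starSlice k (M + 1)) : Summable (starTerm k) := by
  rw [← (starIndexEquiv n).summable_iff]
  refine (summable_sigma_of_nonneg fun x => starTerm_nonneg k (starIndexEquiv n x)).2 ?_
  refine ⟨fun M => (hasSum_fintype _).summable, ?_⟩
  simpa only [Function.comp, tsum_fintype, sum_fiber_starTerm] using h

lemma hasSum_starSlice {n : ℕ} {k : Fin (n + 1) → ℕ}
    (h : Summable (starTerm k)) : HasSum (fun M => starSlice k (M + 1)) (zetaStar k) := by
  refine ((starIndexEquiv n).hasSum_iff.2 h.hasSum).sigma fun M => ?_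
  rw [← sum_fiber_starTerm]
  exact hasSum_fintype _

lemma summable_altStarTerm {n : ℕ} {k : Fin (n + 1) → ℕ}
    (h : Summable (starTerm k)) : Summable (altStarTerm k) := by
  refine h.of_norm_bounded fun m => le_of_eq ?_
  rw [altStarTerm_eq, norm_mul, norm_pow, norm_neg, norm_one, one_pow, one_mul,
    Real.norm_of_nonneg (starTerm_nonneg _ _)]

lemma hasSum_alternating_starSlice {n : ℕ} {k : Fin (n + 1) → ℕ}
    (h : Summable (altStarTerm k)) :
    HasSum (fun M => (-1) ^ M * starSlice k (M + 1)) (altZetaStar k) := by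
  refine ((starIndexEquiv n).hasSum_iff.2 h.hasSum).sigma fun M => ?_
  rw [← sum_fiber_starTerm, Finset.mul_sum]
  have hm (m : boundedTuples n (M + 1)) : altStarTerm k (starIndexEquiv n ⟨M, m⟩) =
      (-1) ^ M * starTerm k (starIndexEquiv n ⟨M, m⟩) := by
    have hl : (starIndexEquiv n ⟨M, m⟩).1 (Fin.last n) = M + 1 :=
      Fin.snoc_last (α := fun _ => ℕ) (M + 1) m.1
    rw [altStarTerm_eq, hl, Nat.add_sub_cancel]
  simp_rw [← hm]
  exact hasSum_fintype fun m => altStarTerm k (starIndexEquiv n ⟨M, m⟩)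

/-! ### Absolute convergence -/

lemma truncatedStar_le {n : ℕ} {k : Fin n → ℕ} (hk : ∀ j, 1 ≤ k j) (N : ℕ) :
    truncatedStar k N ≤ (harmonic N : ℝ) ^ n := by
  calc truncatedStar k N
      ≤ ∑ m ∈ Fintype.piFinset fun _ : Fin n => Finset.Icc 1 N, ∏ j, (m j : ℝ)⁻¹ := by
        refine (Finset.sum_le_sum fun m hm => ?_).trans
          (Finset.sum_le_sum_of_subset_of_nonneg (Finset.filter_subset _ _)
            fun _ _ _ => Finset.prod_nonneg fun _ _ => by positivity)
        refine Finset.prod_le_prod (fun _ _ => by positivity) fun j _ => ?_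
        have h1 : (1 : ℝ) ≤ m j := by exact_mod_cast ((mem_boundedTuples.1 hm).1 j).1
        exact inv_anti₀ (by linarith) (le_self_pow₀ h1 (by have := hk j; omega))
    _ = (harmonic N : ℝ) ^ n := by
        rw [← Finset.prod_univ_sum (fun _ : Fin n => Finset.Icc 1 N) fun _ m => (m : ℝ)⁻¹]
        rw [Finset.prod_const, Finset.card_univ, Fintype.card_fin, harmonic_eq_sum_Icc]
        push_cast
        rfl

lemma summable_harmonic_pow_div_sq (n : ℕ) :
    Summable fun M : ℕ => (harmonic (M + 1) : ℝ) ^ n / ((M : ℝ) + 1) ^ 2 := by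
  have hε : (0 : ℝ) < 1 / (2 * (n + 1)) := by positivity
  set ε : ℝ := 1 / (2 * (n + 1)) with hεd
  have hs : Summable fun M : ℕ => (1 + 1 / ε) ^ n * (1 / (((M + 1 : ℕ) : ℝ) ^ (3 / 2 : ℝ))) :=
    ((summable_nat_add_iff 1).2
      (Real.summable_one_div_nat_rpow (p := 3 / 2).2 (by norm_num))).mul_left _
  refine hs.of_nonneg_of_le (fun M => ?_) fun M => ?_
  · have : (0 : ℝ) ≤ harmonic (M + 1) := by exact_mod_cast (harmonic_pos (by omega)).le
    positivity
  have hx : (1 : ℝ) ≤ ((M + 1 : ℕ) : ℝ) := by push_cast; linarith [M.cast_nonneg (α := ℝ)]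
  have h0 : (0 : ℝ) ≤ harmonic (M + 1) := by exact_mod_cast (harmonic_pos (by omega)).le
  have hH := harmonic_le_one_add_log (M + 1)
  rw [show (M : ℝ) + 1 = ((M + 1 : ℕ) : ℝ) by push_cast; rfl]
  set x : ℝ := ((M + 1 : ℕ) : ℝ)
  have hx0 : 0 < x := by linarith
  have h1 : (harmonic (M + 1) : ℝ) ≤ (1 + 1 / ε) * x ^ ε := by
    have h2 := Real.log_le_rpow_div hx0.le hε
    have h3 := Real.one_le_rpow hx hε.le
    calc _ ≤ _ := hH
      _ ≤ x ^ ε + x ^ ε / ε := add_le_add h3 h2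
      _ = _ := by ring
  have h4 : (x ^ ε) ^ n ≤ x ^ (1 / 2 : ℝ) := by
    rw [← Real.rpow_natCast, ← Real.rpow_mul hx0.le]
    refine Real.rpow_le_rpow_of_exponent_le hx ?_
    rw [hεd, div_mul_eq_mul_div, div_le_div_iff₀ (by positivity) (by positivity)]
    linarith
  have h5 : x ^ 2 = x ^ (1 / 2 : ℝ) * x ^ (3 / 2 : ℝ) := by
    rw [← Real.rpow_add hx0, ← Real.rpow_natCast]; norm_num
  calc (harmonic (M + 1) : ℝ) ^ n / x ^ 2 ≤ ((1 + 1 / ε) * x ^ ε) ^ n / x ^ 2 := by gcongr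
    _ = (1 + 1 / ε) ^ n * ((x ^ ε) ^ n / x ^ 2) := by rw [mul_pow]; ring
    _ ≤ (1 + 1 / ε) ^ n * (x ^ (1 / 2 : ℝ) / x ^ 2) := by gcongr
    _ = _ := by
      rw [h5]
      have := Real.rpow_pos_of_pos hx0 (1 / 2)
      have := Real.rpow_pos_of_pos hx0 (3 / 2)
      field_simp

lemma summable_starSlice {n : ℕ} {k : Fin (n + 1) → ℕ} (hk : ∀ j, 1 ≤ k j)
    (hl : 2 ≤ k (Fin.last n)) : Summable fun M => starSlice k (M + 1) := by
  refine (summable_harmonic_pow_div_sq n).of_nonneg_of_le (fun M => starSlice_nonneg _ _)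
    fun M => ?_
  have hx : (1 : ℝ) ≤ ((M + 1 : ℕ) : ℝ) := by push_cast; linarith [M.cast_nonneg (α := ℝ)]
  rw [starSlice, div_eq_inv_mul, show (M : ℝ) + 1 = ((M + 1 : ℕ) : ℝ) by push_cast; rfl]
  have h := truncatedStar_le (k := Fin.init k) (fun j => hk _) (M + 1)
  have := pow_le_pow_right₀ hx hl
  have := truncatedStar_nonneg (Fin.init k) (M + 1)
  gcongr

/-! ### Sums over compositions -/

lemma mem_positiveTuples {n w : ℕ} {k : Fin n → ℕ} :
    k ∈ positiveTuples n w ↔ ∑ j, k j = w ∧ ∀ j, 1 ≤ k j := by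
  simp [positiveTuples, Finset.Nat.mem_antidiagonalTuple]

lemma positiveTuples_eq_empty {n w : ℕ} (h : w < n) : positiveTuples n w = ∅ := by
  refine Finset.eq_empty_of_forall_notMem fun k hk => ?_
  rw [mem_positiveTuples] at hk
  have := Finset.sum_le_sum fun j (_ : j ∈ Finset.univ) => hk.2 j
  simp at this
  omega

lemma addToLast_last {i : ℕ} (k : Fin (i + 1) → ℕ) (c : ℕ) :
    addToLast k c (Fin.last i) = k (Fin.last i) + c := by
  simp [addToLast]

lemma addToLast_castSucc {i : ℕ} (k : Fin (i + 1) → ℕ) (c : ℕ) (j : Fin i) :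
    addToLast k c j.castSucc = k j.castSucc := by
  simp [addToLast, Fin.castSucc_ne_last]

lemma init_addToLast {i : ℕ} (k : Fin (i + 1) → ℕ) (c : ℕ) :
    Fin.init (addToLast k c) = Fin.init k :=
  funext fun j => addToLast_castSucc k c j

lemma le_addToLast {i : ℕ} (k : Fin (i + 1) → ℕ) (c : ℕ) (j : Fin (i + 1)) :
    k j ≤ addToLast k c j := by
  induction j using Fin.lastCases with
  | last => rw [addToLast_last]; omega
  | cast j => rw [addToLast_castSucc]

/-- Compositions of `w + 1` are split according to whether the last part exceeds `1`. -/
lemma sum_positiveTuples_succ {i w : ℕ} (f : (Fin (i + 1) → ℕ) → ℝ) :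
    ∑ k ∈ positiveTuples (i + 1) (w + 1), f k =
      ∑ k ∈ positiveTuples (i + 1) w, f (addToLast k 1) +
        ∑ k ∈ positiveTuples i w, f (Fin.snoc k 1) := by
  rw [← Finset.sum_filter_not_add_sum_filter _ fun k => k (Fin.last i) = 1]
  congr 1
  · refine Finset.sum_bij' (fun k _ => Function.update k (Fin.last i) (k (Fin.last i) - 1))
      (fun k _ => addToLast k 1) ?_ ?_ ?_ ?_ ?_
    · intro k hk
      rw [Finset.mem_filter, mem_positiveTuples, Fin.sum_univ_castSucc] at hk
      have hl := hk.1.2 (Fin.last i)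
      rw [mem_positiveTuples, Fin.sum_univ_castSucc]
      simp only [Function.update_self, ne_eq, Fin.castSucc_ne_last, not_false_eq_true,
        Function.update_of_ne]
      refine ⟨by omega, fun j => ?_⟩
      induction j using Fin.lastCases with
      | last => rw [Function.update_self]; omega
      | cast j => simpa [Fin.castSucc_ne_last] using hk.1.2 j.castSucc
    · intro k hk
      rw [mem_positiveTuples, Fin.sum_univ_castSucc] at hk
      have hl := hk.2 (Fin.last i)
      rw [Finset.mem_filter, mem_positiveTuples, Fin.sum_univ_castSucc]
      simp only [addToLast_last, addToLast_castSucc]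
      exact ⟨⟨by omega, fun j => (hk.2 j).trans (le_addToLast k 1 j)⟩, by omega⟩
    · intro k hk
      rw [Finset.mem_filter, mem_positiveTuples] at hk
      simp [addToLast, Nat.sub_add_cancel (hk.1.2 (Fin.last i))]
    · intro k hk
      simp [addToLast]
    · intro k hk
      rw [Finset.mem_filter, mem_positiveTuples] at hk
      simp [addToLast, Nat.sub_add_cancel (hk.1.2 (Fin.last i))]
  · have hsnoc (k : Fin (i + 1) → ℕ) (hl : k (Fin.last i) = 1) :
        (Fin.snoc (Fin.init k) 1 : Fin (i + 1) → ℕ) = k := by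
      have h := Fin.snoc_init_self k
      rwa [hl] at h
    refine Finset.sum_bij' (fun k _ => Fin.init k) (fun k _ => Fin.snoc k 1) ?_ ?_ ?_ ?_ ?_
    · intro k hk
      rw [Finset.mem_filter, mem_positiveTuples, Fin.sum_univ_castSucc] at hk
      rw [mem_positiveTuples]
      refine ⟨?_, fun j => hk.1.2 _⟩
      simp only [Fin.init]
      omega
    · intro k hk
      rw [mem_positiveTuples] at hk
      rw [Finset.mem_filter, mem_positiveTuples, Fin.sum_univ_castSucc]
      simp only [Fin.snoc_castSucc, Fin.snoc_last]
      refine ⟨⟨by omega, fun j => ?_⟩, trivial⟩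
      induction j using Fin.lastCases with
      | last => simp
      | cast j => simpa using hk.2 j
    · intro k hk
      exact hsnoc k (Finset.mem_filter.1 hk).2
    · intro k hk
      simp
    · intro k hk
      rw [hsnoc k (Finset.mem_filter.1 hk).2]

lemma starSlice_addToLast {i : ℕ} (k : Fin (i + 1) → ℕ) (c M : ℕ) :
    starSlice (addToLast k c) M = ((M : ℝ) ^ c)⁻¹ * starSlice k M := by
  rw [starSlice, starSlice, init_addToLast, addToLast_last, pow_add, mul_inv]
  ring

lemma starSlice_snoc {i : ℕ} (k : Fin i → ℕ) (c M : ℕ) :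
    starSlice (Fin.snoc k c : Fin (i + 1) → ℕ) M = ((M : ℝ) ^ c)⁻¹ * truncatedStar k M := by
  simp [starSlice]

/-- The sum `∑ (-1) ^ (w - i - 1) 2 ^ (i + 1)` over all compositions of `w` into `i + 1` parts of
the slices of the star sums. It is the coefficient of `y ^ w` in
`2 y / (M - y) * ∏_{m < M} (m + y) / (m - y)`. The sign is written as `(-1) ^ (w + 1 + i)` to avoid
truncated subtraction. -/
noncomputable def compositionSlice (w M : ℕ) : ℝ :=
  ∑ i ∈ Finset.range w, (-1 : ℝ) ^ (w + 1 + i) * 2 ^ (i + 1) *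
    ∑ k ∈ positiveTuples (i + 1) w, starSlice k M

/-- The sum `∑ (-1) ^ (w - i) 2 ^ i` over all compositions of `w` into `i` parts of the truncated
star sums. It is the coefficient of `y ^ w` in `∏_{m ≤ N} (m + y) / (m - y)`. -/
noncomputable def compositionSum (w N : ℕ) : ℝ :=
  ∑ i ∈ Finset.range (w + 1), (-1 : ℝ) ^ (w + i) * 2 ^ i *
    ∑ k ∈ positiveTuples i w, truncatedStar k N

lemma compositionSum_add_one (w N : ℕ) :
    compositionSum w (N + 1) = compositionSum w N + compositionSlice w (N + 1) := by
  simp only [compositionSum, compositionSlice]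
  rw [Finset.sum_range_succ', Finset.sum_range_succ' (n := w)]
  simp only [truncatedStar_zero, truncatedStar_succ, Finset.sum_range_succ (n := N),
    Finset.sum_add_distrib, mul_add, add_assoc, add_comm 1]
  ring

lemma compositionSum_zero_right (w : ℕ) : compositionSum w 0 = if w = 0 then 1 else 0 := by
  rw [compositionSum, Finset.sum_range_succ']
  simp only [truncatedStar_zero, truncatedStar_succ, Finset.range_zero, Finset.sum_empty,
    Finset.sum_const_zero, mul_zero, zero_add]
  rcases Nat.eq_zero_or_pos w with rfl | hw
  · simp [positiveTuples]
  · rw [if_neg hw.ne']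
    have : positiveTuples 0 w = ∅ := by
      refine Finset.eq_empty_of_forall_notMem fun k hk => ?_
      rw [mem_positiveTuples, Fin.sum_univ_zero] at hk
      omega
    simp [this]

lemma compositionSum_zero_left (N : ℕ) : compositionSum 0 N = 1 := by
  induction N with
  | zero => simp [compositionSum_zero_right]
  | succ N ih => rw [compositionSum_add_one, ih]; simp [compositionSlice]

/-- The coefficient form of `(n - y) P_n = (n + y) P_{n - 1}` for
`P_n = ∏_{m ≤ n} (m + y) / (m - y)`. -/
lemma mul_compositionSlice (w n : ℕ) :
    ((n : ℝ) + 1) * compositionSlice (w + 1) (n + 1) =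
      compositionSum w (n + 1) + compositionSum w n := by
  have h : ((n : ℝ) + 1) * compositionSlice (w + 1) (n + 1) =
      2 * compositionSum w (n + 1) - compositionSlice w (n + 1) := by
    have hE : compositionSlice w (n + 1) =
        ∑ i ∈ Finset.range (w + 1), (-1 : ℝ) ^ (w + 1 + i) * 2 ^ (i + 1) *
          ∑ k ∈ positiveTuples (i + 1) w, starSlice k (n + 1) := by
      rw [Finset.sum_range_succ, positiveTuples_eq_empty (Nat.lt_succ_self w),
        Finset.sum_empty, mul_zero, add_zero, compositionSlice]
    rw [hE, compositionSum, compositionSlice, Finset.mul_sum, Finset.mul_sum,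
      ← Finset.sum_sub_distrib]
    refine Finset.sum_congr rfl fun i _ => ?_
    have hn : (n : ℝ) + 1 ≠ 0 := by positivity
    simp only [sum_positiveTuples_succ, starSlice_addToLast, starSlice_snoc, ← Finset.mul_sum]
    push_cast
    field_simp
    ring
  rw [h, compositionSum_add_one]
  ring

/-! ### The truncated identity -/

/-- In generating function form this is
`N / (N - y) = ∑_{n ≤ N} (-1) ^ (n - 1) * centralWeight N n * (P_n + P_{n - 1})` with
`P_n = ∏_{m ≤ n} (m + y) / (m - y)`. -/
lemma sum_centralWeight_compositionSum (r : ℕ) {N : ℕ} (hN : 0 < N) :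
    ∑ n ∈ Finset.range N, (-1 : ℝ) ^ n * centralWeight N (n + 1) *
      (compositionSum r (n + 1) + compositionSum r n) = ((N : ℝ) ^ r)⁻¹ := by
  have hN0 : (N : ℝ) ≠ 0 := by positivity
  induction r with
  | zero =>
    have h := sum_centralWeight_telescope (fun _ => 1) N
    apply mul_left_cancel₀ hN0
    rw [pow_zero, inv_one, ← h, Finset.mul_sum]
    refine Finset.sum_congr rfl fun n _ => ?_
    simp only [compositionSum_zero_left]
    ring
  | succ r ih =>
    have h := sum_centralWeight_telescope (compositionSum (r + 1)) N
    rw [compositionSum_zero_right, if_neg (Nat.succ_ne_zero r), mul_zero] at h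
    apply mul_left_cancel₀ hN0
    have h2 : (N : ℝ) * ((N : ℝ) ^ (r + 1))⁻¹ = ((N : ℝ) ^ r)⁻¹ := by
      rw [pow_succ]
      field_simp
    rw [h2, ← ih, ← sub_eq_zero, ← h, Finset.mul_sum, ← Finset.sum_sub_distrib]
    refine Finset.sum_congr rfl fun n _ => ?_
    have h3 := compositionSum_add_one (r + 1) n
    have h4 := mul_compositionSlice r n
    linear_combination (-1 : ℝ) ^ n * centralWeight N (n + 1) * ((n + 1) * h3 + h4)

lemma truncatedStar_headThenTwos (r t N : ℕ) :
    truncatedStar (headThenTwos (r + 2) (t + 1)) N =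
      ∑ n ∈ Finset.range N, (-1 : ℝ) ^ n * (((n : ℝ) + 1) ^ (2 * t + 1))⁻¹ *
        compositionSlice (r + 1) (n + 1) * centralWeight N (n + 1) := by
  induction t generalizing N with
  | zero =>
    rw [truncatedStar_succ]
    have h1 (M : ℕ) : starSlice (headThenTwos (r + 2) (0 + 1)) (M + 1) = (((M : ℝ) + 1) ^ 2)⁻¹ *
        ∑ n ∈ Finset.range (M + 1), ((-1 : ℝ) ^ n * ((n + 1) * compositionSlice (r + 1) (n + 1))) *
          centralWeight (M + 1) (n + 1) := by
      have h := sum_centralWeight_compositionSum r (Nat.succ_pos M)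
      rw [starSlice, truncatedStar_zero, mul_one]
      simp_rw [mul_compositionSlice, mul_right_comm]
      rw [h, ← mul_inv]
      simp [headThenTwos, pow_add, mul_comm]
    simp_rw [h1]
    rw [sum_inv_sq_mul_centralWeight]
    refine Finset.sum_congr rfl fun n _ => ?_
    have hn : (n : ℝ) + 1 ≠ 0 := by positivity
    field_simp
    ring
  | succ t ih =>
    rw [truncatedStar_succ]
    have h1 (M : ℕ) : starSlice (headThenTwos (r + 2) (t + 1 + 1)) (M + 1) =
        (((M : ℝ) + 1) ^ 2)⁻¹ * truncatedStar (headThenTwos (r + 2) (t + 1)) (M + 1) := by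
      have h2 : Fin.init (headThenTwos (r + 2) (t + 1 + 1)) = headThenTwos (r + 2) (t + 1) := rfl
      rw [starSlice, h2]
      simp [headThenTwos]
    simp_rw [h1, ih]
    rw [sum_inv_sq_mul_centralWeight]
    refine Finset.sum_congr rfl fun n _ => ?_
    have hn : (n : ℝ) + 1 ≠ 0 := by positivity
    field_simp
    ring

/-! ### Passage to the limit -/

lemma summable_altStarTerm_addToLast {i w c : ℕ} (hc : 1 ≤ c) {k : Fin (i + 1) → ℕ}
    (hk : k ∈ positiveTuples (i + 1) w) : Summable (altStarTerm (addToLast k c)) := by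
  rw [mem_positiveTuples] at hk
  refine summable_altStarTerm (summable_starTerm (summable_starSlice
    (fun j => (hk.2 j).trans (le_addToLast k c j)) ?_))
  have := hk.2 (Fin.last i)
  rw [addToLast_last]
  omega

lemma hasSum_compositionSlice (r : ℕ) {c : ℕ} (hc : 1 ≤ c) :
    HasSum (fun n : ℕ => (-1 : ℝ) ^ n * (((n : ℝ) + 1) ^ c)⁻¹ * compositionSlice (r + 1) (n + 1))
      (∑ i ∈ Finset.range (r + 1), (-1 : ℝ) ^ (r - i) * 2 ^ (i + 1) *
        ∑ k ∈ positiveTuples (i + 1) (r + 1), altZetaStar (addToLast k c)) := by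
  have h := hasSum_sum (s := Finset.range (r + 1)) fun i _ =>
    (hasSum_sum (s := positiveTuples (i + 1) (r + 1)) fun k hk =>
      hasSum_alternating_starSlice (summable_altStarTerm_addToLast hc hk)).mul_left
        ((-1 : ℝ) ^ (r - i) * 2 ^ (i + 1))
  refine h.congr_fun fun n => ?_
  rw [compositionSlice, Finset.mul_sum]
  refine Finset.sum_congr rfl fun i hi => ?_
  have hsign : (-1 : ℝ) ^ (r + 1 + 1 + i) = (-1) ^ (r - i) := by
    have : r + 1 + 1 + i = (r - i) + 2 * (i + 1) := by
      have := Finset.mem_range.1 hi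
      omega
    rw [this, pow_add, pow_mul]
    simp
  simp only [hsign, starSlice_addToLast, ← Finset.mul_sum]
  push_cast
  ring

theorem mainTheorem2 (r s : ℕ) (hs : 1 ≤ s) :
    Summable (starTerm (headThenTwos (r + 2) s)) ∧
    (∀ i ∈ Finset.range (r + 1), ∀ k ∈ positiveTuples (i + 1) (r + 1),
      Summable (altStarTerm (addToLast k (2 * s - 1)))) ∧
    zetaStar (headThenTwos (r + 2) s) =
      ∑ i ∈ Finset.range (r + 1), (-1 : ℝ) ^ (r - i) * 2 ^ (i + 1) *
        ∑ k ∈ positiveTuples (i + 1) (r + 1), altZetaStar (addToLast k (2 * s - 1)) := by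
  obtain ⟨t, rfl⟩ := Nat.exists_eq_add_of_le' hs
  have hc : 2 * (t + 1) - 1 = 2 * t + 1 := by omega
  rw [hc]
  have hsum : Summable (starTerm (headThenTwos (r + 2) (t + 1))) :=
    summable_starTerm (summable_starSlice
      (fun j => by unfold headThenTwos; split_ifs <;> omega)
      (by unfold headThenTwos; split_ifs <;> omega))
  refine ⟨hsum, fun i _ k hk => summable_altStarTerm_addToLast (by omega) hk, ?_⟩
  have hF := hasSum_compositionSlice r (c := 2 * t + 1) (by omega)
  have hleft : Filter.Tendsto (truncatedStar (headThenTwos (r + 2) (t + 1))) Filter.atTop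
      (nhds (zetaStar (headThenTwos (r + 2) (t + 1)))) :=
    (hasSum_starSlice hsum).tendsto_sum_nat.congr fun N => (truncatedStar_succ _ N).symm
  -- The weights are bounded by `1` and tend to `1`, so dominated convergence applies.
  have hright := tendsto_tsum_of_dominated_convergence
    (f := fun N n : ℕ => (-1 : ℝ) ^ n * (((n : ℝ) + 1) ^ (2 * t + 1))⁻¹ *
        compositionSlice (r + 1) (n + 1) * centralWeight N (n + 1)) (𝓕 := Filter.atTop)
    hF.summable.norm (fun n => by simpa using (tendsto_centralWeight (n + 1)).const_mul _)
    (Filter.Eventually.of_forall fun N n => by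
      rw [norm_mul, Real.norm_of_nonneg (centralWeight_nonneg _ _)]
      exact mul_le_of_le_one_right (norm_nonneg _) (centralWeight_le_one _ _))
  rw [hF.tsum_eq] at hright
  refine tendsto_nhds_unique hleft (hright.congr fun N => ?_)
  rw [truncatedStar_headThenTwos]
  refine tsum_eq_sum fun n hn => ?_
  rw [centralWeight_eq_zero (by simpa [Nat.lt_succ_iff] using hn), mul_zero]
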